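/- **Corollary (controlling algebra of deformation maps of a matched pair).** Let $\mathbb K$ be a field of characteristic $\neq 2$; associative algebras over $\mathbb K$ are not assumed unital. Let $(A,A',\rho,\mu,\eta,\xi)$ be a matched pair of associative algebras over $\mathbb K$: $(A,\cdot_A)$ and $(A',\cdot_{A'})$ are associative algebras, $\rho,\mu:A\to\mathfrak{gl}(A')$ and $\eta,\xi:A'\to\mathfrak{gl}(A)$ are linear maps such that $(A';\rho,\mu)$ is a representation of $A$, i.e. $\rho(x\cdot_A y)=\rho(x)\rho(y)$, $\mu(x\cdot_A y)=\mu(y)\mu(x)$, $\rho(x)\mu(y)=\mu(y)\rho(x)$, likewise $(A;\eta,\xi)$ is a representation of $A'$, and for all $x,y\in A$, $u,v\in A'$ \begin{align*} \rho(x)(u\cdot_{A'}v)&=\rho(\xi(u)x)v+(\rho(x)u)\cdot_{A'}v, & \mu(x)(u\cdot_{A'}v)&=\mu(\eta(v)x)u+u\cdot_{A'}(\mu(x)v),\\ \eta(u)(x\cdot_{A}y)&=\eta(\mu(x)u)y+(\eta(u)x)\cdot_{A}y, & \xi(u)(x\cdot_{A}y)&=\xi(\rho(y)u)x+x\cdot_{A}(\xi(u)y),\\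 \rho(\eta(u)x)v+(\mu(x)u)\cdot_{A'} v&=\mu(\xi(v)x)u+u\cdot_{A'}(\rho(x)v), & \eta(\rho(x)u)y+(\xi(u)x)\cdot_{A} y&=\xi(\mu(y)u)x+x\cdot_{A}(\eta(u)y). \end{align*} A deformation map of the matched pair is a linear map $B:A'\to A$ such that for all $u,v\in A'$ $$B(u)\cdot_{A}B(v)+\xi(v)B(u)+\eta(u)B(v)=B\big(u\cdot_{A'} v+\rho(B(u))v+\mu(B(v))u\big).$$ Let $\mathfrak g=\bigoplus_{n\ge 0}\mathrm{Hom}(\otimes^{n+1}A',A)$ with $\mathrm{Hom}(\otimes^{n+1}A',A)$ in degree $n$, and let $s\mathfrak g$ be the shifted graded space, $(s\mathfrak g)^i=\mathfrak g^{i-1}$, so that $\mathrm{Hom}(\otimes^{m}A',A)$ has degree $m$ in $s\mathfrak g$. For $f_1\in\mathrm{Hom}(\otimes^{m_1}A',A)$, $f_2\in\mathrm{Hom}(\otimes^{m_2}A',A)$ define $[\![f_1,f_2]\!]\in\mathrm{Hom}(\otimes^{m_1+m_2}A',A)$ by \begin{align*} &[\![f_1,f_2]\!](u_1,\dots,u_{m_1+m_2})\\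 &=f_2(u_1,\dots,u_{m_2})\cdot_{A}f_1(u_{m_2+1},\dots,u_{m_1+m_2})-(-1)^{m_1m_2}f_1(u_1,\dots,u_{m_1})\cdot_{A}f_2(u_{m_1+1},\dots,u_{m_1+m_2})\\ &\quad+\sum_{i=1}^{m_1}(-1)^{im_2}f_1(u_1,\dots,u_{i-1},\mu(f_2(u_{i+1},\dots,u_{i+m_2}))u_i,u_{i+m_2+1},\dots,u_{m_1+m_2})\\ &\quad-\sum_{i=1}^{m_1}(-1)^{(i-1)m_2}f_1(u_1,\dots,u_{i-1},\rho(f_2(u_i,\dots,u_{i+m_2-1}))u_{i+m_2},u_{i+m_2+1},\dots,u_{m_1+m_2})\\ &\quad+(-1)^{m_1m_2}\sum_{i=1}^{m_2}(-1)^{(i-1)m_1}f_2(u_1,\dots,u_{i-1},\rho(f_1(u_i,\dots,u_{i+m_1-1}))u_{i+m_1},u_{i+m_1+1},\dots,u_{m_1+m_2})\\ &\quad-(-1)^{m_1(m_2+1)}\sum_{i=1}^{m_2}(-1)^{(i-1)m_1}f_2(u_1,\dots,u_{i-1},\mu(f_1(u_{i+1},\dots,u_{i+m_1}))u_i,u_{i+m_1+1},\dots,u_{m_1+m_2}),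 \end{align*} and for $f\in\mathrm{Hom}(\otimes^{m}A',A)$ define $\mathrm df\in\mathrm{Hom}(\otimes^{m+1}A',A)$ by \begin{align*} \mathrm df(u_1,\dots,u_{m+1})&=\xi(u_{m+1})f(u_1,\dots,u_m)+(-1)^{m-1}\eta(u_1)f(u_2,\dots,u_{m+1})\\ &\quad+(-1)^{m-1}\sum_{i=1}^m(-1)^if(u_1,\dots,u_{i-1},u_i\cdot_{A'}u_{i+1},u_{i+2},\dots,u_{m+1}). \end{align*} Then $(s\mathfrak g,[\![\cdot,\cdot]\!],\mathrm d)$, with the bilinear and linear extensions of these operations, is a differential graded Lie algebra: $[\![\cdot,\cdot]\!]$ has degree $0$, is graded skew-symmetric and satisfies the graded Jacobi identity, and $\mathrm d$ is a derivation of degree $1$ of the bracket with $\mathrm d^2=0$. Moreover, its Maurer–Cartan elements, i.e. the elements $x$ of degree $1$ with $\mathrm dx+\tfrac12[\![x,x]\!]=0$, are exactly the deformation maps of the matched pair $(A,A')$, regarded as elements of $\mathrm{Hom}(\otimes^1A',A)=\mathrm{Hom}(A',A)$. -/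

import Mathlib

/-! ### Matched pairs of associative algebras and their deformation maps

Associative algebras over a field are not assumed to have a unit: they are `NonUnitalRing`s with
a compatible vector space structure. -/

/-- A representation `(V; l, r)` of an associative algebra `A` on a vector space `V`. -/
structure IsAssocRep {K A V : Type*} [Field K]
    [NonUnitalRing A] [Module K A] [AddCommGroup V] [Module K V]
    (l r : A →ₗ[K] Module.End K V) : Prop where
  left_mul : ∀ x y : A, l (x * y) = l x ∘ₗ l y
  right_mul : ∀ x y : A, r (x * y) = r y ∘ₗ r x
  left_right : ∀ x y : A, l x ∘ₗ r y = r y ∘ₗ l x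

/-- A matched pair `(A, A', ρ, μ, η, ξ)` of associative algebras. -/
structure MatchedPair (K A A' : Type*) [Field K]
    [NonUnitalRing A] [Module K A] [NonUnitalRing A'] [Module K A'] where
  ρ : A →ₗ[K] Module.End K A'
  μ : A →ₗ[K] Module.End K A'
  η : A' →ₗ[K] Module.End K A
  ξ : A' →ₗ[K] Module.End K A
  rep : IsAssocRep ρ μ
  rep' : IsAssocRep η ξ
  ρ_mul : ∀ (x : A) (u v : A'), ρ x (u * v) = ρ (ξ u x) v + ρ x u * v
  μ_mul : ∀ (x : A) (u v : A'), μ x (u * v) = μ (η v x) u + u * μ x v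
  η_mul : ∀ (u : A') (x y : A), η u (x * y) = η (μ x u) y + η u x * y
  ξ_mul : ∀ (u : A') (x y : A), ξ u (x * y) = ξ (ρ y u) x + x * ξ u y
  mid : ∀ (x : A) (u v : A'), ρ (η u x) v + μ x u * v = μ (ξ v x) u + u * ρ x v
  mid' : ∀ (u : A') (x y : A), η (ρ x u) y + ξ u x * y = ξ (μ y u) x + x * η u y

/-- A deformation map of a matched pair `(A, A')`. -/
def MatchedPair.IsDeformationMap {K A A' : Type*} [Field K]
    [NonUnitalRing A] [Module K A] [NonUnitalRing A'] [Module K A']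
    (P : MatchedPair K A A') (B : A' →ₗ[K] A) : Prop :=
  ∀ u v : A', B u * B v + P.ξ v (B u) + P.η u (B v) =
    B (u * v + P.ρ (B u) v + P.μ (B v) u)

/-! ### Differential graded Lie algebras -/

/-- `(L, br, d)`, graded by the submodules `gr i` (`i : ℤ`), is a differential graded Lie algebra:
the bracket has degree `0` and the differential has degree `1`. -/
structure IsDGLieAlgebra {K L : Type*} [Field K] [AddCommGroup L] [Module K L]
    (gr : ℤ → Submodule K L) (br : L →ₗ[K] L →ₗ[K] L) (d : L →ₗ[K] L) : Prop where
  isInternal : DirectSum.IsInternal gr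
  bracket_mem : ∀ (i j : ℤ) (x y : L), x ∈ gr i → y ∈ gr j → br x y ∈ gr (i + j)
  skew : ∀ (i j : ℤ) (x y : L), x ∈ gr i → y ∈ gr j →
    br x y = -((-1 : K) ^ (i * j) • br y x)
  jacobi : ∀ (i j k : ℤ) (x y z : L), x ∈ gr i → y ∈ gr j → z ∈ gr k →
    br x (br y z) = br (br x y) z + (-1 : K) ^ (i * j) • br y (br x z)
  d_mem : ∀ (i : ℤ) (x : L), x ∈ gr i → d x ∈ gr (i + 1)
  d_d : ∀ x : L, d (d x) = 0
  leibniz : ∀ (i j : ℤ) (x y : L), x ∈ gr i → y ∈ gr j →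
    d (br x y) = br (d x) y + (-1 : K) ^ i • br x (d y)

/-- Maurer-Cartan elements of a differential graded Lie algebra: the elements `x` of degree `1`
with `d x + ½ [x, x] = 0`. -/
def IsMaurerCartan {K L : Type*} [Field K] [AddCommGroup L] [Module K L]
    (gr : ℤ → Submodule K L) (br : L →ₗ[K] L →ₗ[K] L) (d : L →ₗ[K] L) (x : L) : Prop :=
  x ∈ gr 1 ∧ d x + (2⁻¹ : K) • br x x = 0

/-! ### Multilinear maps -/

section Multilinear

variable {K : Type*} [Field K]
  {V W X Y : Type*} [AddCommGroup V] [Module K V] [AddCommGroup W] [Module K W]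
  [AddCommGroup X] [Module K X] [AddCommGroup Y] [Module K Y]

/-- `Hom(⊗ᵐ V, W)`. -/
abbrev Cochain (K V W : Type*) [Field K] [AddCommGroup V] [Module K V]
    [AddCommGroup W] [Module K W] (m : ℕ) : Type _ :=
  MultilinearMap K (fun _ : Fin m => V) W

/-- The identity of `V`, as an element of `Hom(⊗¹ V, V)`. -/
def idCochain (K V : Type*) [Field K] [AddCommGroup V] [Module K V] : Cochain K V V 1 :=
  MultilinearMap.ofSubsingleton K V V 0 LinearMap.id


theorem update_comp_apply_self {S : Type*} {m N : ℕ} (φ : Fin m → Fin N) (hφ : Function.Injective φ)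
    [DecidableEq (Fin N)] (u : Fin N → S) (j : Fin m) (z : S) :
    (fun l => Function.update u (φ j) z (φ l)) = Function.update (fun l => u (φ l)) j z := by
  funext l
  by_cases hl : l = j
  · subst hl; simp
  · rw [Function.update_of_ne hl, Function.update_of_ne (fun h => hl (hφ h))]

theorem update_comp_of_ne {S : Type*} {m N : ℕ} (φ : Fin m → Fin N) [DecidableEq (Fin N)]
    (u : Fin N → S) (k : Fin N) (hk : ∀ l, φ l ≠ k) (z : S) :
    (fun l => Function.update u k z (φ l)) = fun l => u (φ l) := by
  funext l
  rw [Function.update_of_ne (hk l)]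

/-- For a bilinear map `b`, the cochain
`(u₁, …, u_{m+n}) ↦ b (f (u₁, …, u_m)) (g (u_{m+1}, …, u_{m+n}))`, where `N = m + n`. -/
def pairing (b : W →ₗ[K] X →ₗ[K] Y) {m n N : ℕ} (h : N = m + n)
    (f : Cochain K V W m) (g : Cochain K V X n) : Cochain K V Y N where
  toFun u := b (f fun i => u ⟨i, by omega⟩) (g fun j => u ⟨m + j, by omega⟩)
  map_update_add' := by
    intro _ u k x y
    let φ : Fin m → Fin N := fun i => ⟨i, by omega⟩
    let ψ : Fin n → Fin N := fun j => ⟨m + j, by omega⟩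
    have hφ : Function.Injective φ := fun a c hac => by simpa [φ, Fin.ext_iff] using hac
    have hψ : Function.Injective ψ := fun a c hac => by simpa [ψ, Fin.ext_iff] using hac
    change b (f fun i => Function.update u k (x + y) (φ i))
        (g fun i => Function.update u k (x + y) (ψ i)) =
      b (f fun i => Function.update u k x (φ i)) (g fun i => Function.update u k x (ψ i)) +
      b (f fun i => Function.update u k y (φ i)) (g fun i => Function.update u k y (ψ i))
    by_cases hk : (k : ℕ) < m
    · obtain ⟨j, rfl⟩ : ∃ j, φ j = k := ⟨⟨k, hk⟩, rfl⟩
      have hne : ∀ l, ψ l ≠ φ j := fun l hl => by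
        simp only [ψ, φ, Fin.ext_iff] at hl; omega
      simp only [update_comp_apply_self φ hφ, update_comp_of_ne ψ u _ hne, MultilinearMap.map_update_add,
        map_add, LinearMap.add_apply]
    · obtain ⟨j, rfl⟩ : ∃ j, ψ j = k :=
        ⟨⟨k - m, by omega⟩, by simp only [ψ, Fin.ext_iff]; omega⟩
      have hne : ∀ l, φ l ≠ ψ j := fun l hl => by
        simp only [ψ, φ, Fin.ext_iff] at hl; omega
      simp only [update_comp_apply_self ψ hψ, update_comp_of_ne φ u _ hne, MultilinearMap.map_update_add, map_add]
  map_update_smul' := by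
    intro _ u k c x
    let φ : Fin m → Fin N := fun i => ⟨i, by omega⟩
    let ψ : Fin n → Fin N := fun j => ⟨m + j, by omega⟩
    have hφ : Function.Injective φ := fun a c hac => by simpa [φ, Fin.ext_iff] using hac
    have hψ : Function.Injective ψ := fun a c hac => by simpa [ψ, Fin.ext_iff] using hac
    change b (f fun i => Function.update u k (c • x) (φ i))
        (g fun i => Function.update u k (c • x) (ψ i)) =
      c • b (f fun i => Function.update u k x (φ i)) (g fun i => Function.update u k x (ψ i))
    by_cases hk : (k : ℕ) < m
    · obtain ⟨j, rfl⟩ : ∃ j, φ j = k := ⟨⟨k, hk⟩, rfl⟩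
      have hne : ∀ l, ψ l ≠ φ j := fun l hl => by
        simp only [ψ, φ, Fin.ext_iff] at hl; omega
      simp only [update_comp_apply_self φ hφ, update_comp_of_ne ψ u _ hne, MultilinearMap.map_update_smul,
        map_smul, LinearMap.smul_apply]
    · obtain ⟨j, rfl⟩ : ∃ j, ψ j = k :=
        ⟨⟨k - m, by omega⟩, by simp only [ψ, Fin.ext_iff]; omega⟩
      have hne : ∀ l, φ l ≠ ψ j := fun l hl => by
        simp only [ψ, φ, Fin.ext_iff] at hl; omega
      simp only [update_comp_apply_self ψ hψ, update_comp_of_ne φ u _ hne, MultilinearMap.map_update_smul, map_smul]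

/-- The arguments of `f` in `insertAt`: away from `i`, they are the entries of `u` that are not
arguments of `g`; the entry number `i` is `w`. -/
def insertArgs {S : Type*} {m k N : ℕ} (h : N = m + k) (i : Fin m)
    (u : Fin N → S) (w : S) : Fin m → S :=
  Function.update
    (fun j : Fin m => if j < i then u ⟨j, by omega⟩ else u ⟨j + k, by omega⟩) i w

theorem insertArgs_update {S : Type*} {m k N : ℕ} (h : N = m + k) (i : Fin m)
    [DecidableEq (Fin N)] (u : Fin N → S) (t : Fin N) :
    (∃ j : Fin m, j ≠ i ∧
      (∀ z w, insertArgs h i (Function.update u t z) w =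
        Function.update (insertArgs h i u w) j z) ∧
      ∀ (l : Fin (k + 1)), (⟨i + l, by omega⟩ : Fin N) ≠ t) ∨
    ((∃ l : Fin (k + 1), (⟨i + l, by omega⟩ : Fin N) = t) ∧
      ∀ z w, insertArgs h i (Function.update u t z) w = insertArgs h i u w) := by
  by_cases h1 : (t : ℕ) < i
  · refine Or.inl ⟨⟨t, by omega⟩, fun hh => ?_, fun z w => ?_, fun l hl => ?_⟩
    · simp only [Fin.ext_iff] at hh; omega
    · funext j
      simp only [insertArgs, Function.update_apply, Fin.ext_iff, Fin.lt_def]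
      split_ifs <;> first | rfl | omega
    · simp only [Fin.ext_iff] at hl; omega
  · by_cases h2 : (t : ℕ) ≤ i + k
    · refine Or.inr ⟨⟨⟨t - i, by omega⟩, by simp only [Fin.ext_iff]; omega⟩, fun z w => ?_⟩
      funext j
      simp only [insertArgs, Function.update_apply, Fin.ext_iff, Fin.lt_def]
      split_ifs <;> first | rfl | omega
    · refine Or.inl ⟨⟨t - k, by omega⟩, fun hh => ?_, fun z w => ?_, fun l hl => ?_⟩
      · simp only [Fin.ext_iff] at hh; omega
      · funext j
        simp only [insertArgs, Function.update_apply, Fin.ext_iff, Fin.lt_def]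
        split_ifs <;> first | rfl | omega
      · simp only [Fin.ext_iff] at hl; omega

/-- The cochain `(u₁, …, u_{m+k}) ↦ f (u₁, …, u_i, g (u_{i+1}, …, u_{i+k+1}), u_{i+k+2}, …)`
obtained by inserting `g`, which has `k + 1` arguments, into the argument of `f` with the
(zero-based) number `i`; here `N = m + k`. -/
def insertAt {m k N : ℕ} (h : N = m + k) (i : Fin m)
    (f : Cochain K V W m) (g : Cochain K V V (k + 1)) : Cochain K V W N where
  toFun u := f (insertArgs h i u (g fun l => u ⟨i + l, by omega⟩))
  map_update_add' := by
    intro _ u t x y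
    let ψ : Fin (k + 1) → Fin N := fun l => ⟨i + l, by omega⟩
    have hψ : Function.Injective ψ := fun a c hac => by simpa [ψ, Fin.ext_iff] using hac
    change f (insertArgs h i (Function.update u t (x + y))
        (g fun l => Function.update u t (x + y) (ψ l))) =
      f (insertArgs h i (Function.update u t x) (g fun l => Function.update u t x (ψ l))) +
      f (insertArgs h i (Function.update u t y) (g fun l => Function.update u t y (ψ l)))
    rcases insertArgs_update h i u t with ⟨j, _, hj, hne⟩ | ⟨⟨l, hl⟩, hi⟩
    · simp only [update_comp_of_ne ψ u t hne, hj, MultilinearMap.map_update_add]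
    · obtain rfl : ψ l = t := hl
      simp only [hi]
      simp only [insertArgs, update_comp_apply_self ψ hψ, MultilinearMap.map_update_add]
  map_update_smul' := by
    intro _ u t c x
    let ψ : Fin (k + 1) → Fin N := fun l => ⟨i + l, by omega⟩
    have hψ : Function.Injective ψ := fun a c hac => by simpa [ψ, Fin.ext_iff] using hac
    change f (insertArgs h i (Function.update u t (c • x))
        (g fun l => Function.update u t (c • x) (ψ l))) =
      c • f (insertArgs h i (Function.update u t x) (g fun l => Function.update u t x (ψ l)))
    rcases insertArgs_update h i u t with ⟨j, _, hj, hne⟩ | ⟨⟨l, hl⟩, hi⟩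
    · simp only [update_comp_of_ne ψ u t hne, hj, MultilinearMap.map_update_smul]
    · obtain rfl : ψ l = t := hl
      simp only [hi]
      simp only [insertArgs, update_comp_apply_self ψ hψ, MultilinearMap.map_update_smul]

theorem pairing_add_left (b : W →ₗ[K] X →ₗ[K] Y) {m n N : ℕ} (h : N = m + n)
    (f f' : Cochain K V W m) (g : Cochain K V X n) :
    pairing b h (f + f') g = pairing b h f g + pairing b h f' g := by
  ext u; simp [pairing]

theorem pairing_add_right (b : W →ₗ[K] X →ₗ[K] Y) {m n N : ℕ} (h : N = m + n)
    (f : Cochain K V W m) (g g' : Cochain K V X n) :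
    pairing b h f (g + g') = pairing b h f g + pairing b h f g' := by
  ext u; simp [pairing]

theorem pairing_smul_left (b : W →ₗ[K] X →ₗ[K] Y) {m n N : ℕ} (h : N = m + n) (c : K)
    (f : Cochain K V W m) (g : Cochain K V X n) :
    pairing b h (c • f) g = c • pairing b h f g := by
  ext u; simp [pairing]

theorem pairing_smul_right (b : W →ₗ[K] X →ₗ[K] Y) {m n N : ℕ} (h : N = m + n) (c : K)
    (f : Cochain K V W m) (g : Cochain K V X n) :
    pairing b h f (c • g) = c • pairing b h f g := by
  ext u; simp [pairing]

theorem insertAt_add_left {m k N : ℕ} (h : N = m + k) (i : Fin m)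
    (f f' : Cochain K V W m) (g : Cochain K V V (k + 1)) :
    insertAt h i (f + f') g = insertAt h i f g + insertAt h i f' g := by
  ext u; simp [insertAt]

theorem insertAt_add_right {m k N : ℕ} (h : N = m + k) (i : Fin m)
    (f : Cochain K V W m) (g g' : Cochain K V V (k + 1)) :
    insertAt h i f (g + g') = insertAt h i f g + insertAt h i f g' := by
  ext u; simp [insertAt, insertArgs]

theorem insertAt_smul_left {m k N : ℕ} (h : N = m + k) (i : Fin m) (c : K)
    (f : Cochain K V W m) (g : Cochain K V V (k + 1)) :
    insertAt h i (c • f) g = c • insertAt h i f g := by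
  ext u; simp [insertAt]

theorem insertAt_smul_right {m k N : ℕ} (h : N = m + k) (i : Fin m) (c : K)
    (f : Cochain K V W m) (g : Cochain K V V (k + 1)) :
    insertAt h i f (c • g) = c • insertAt h i f g := by
  ext u; simp [insertAt, insertArgs]

end Multilinear

/-! ### The controlling algebra -/

namespace MatchedPair

variable {K A A' : Type*} [Field K]
  [NonUnitalRing A] [Module K A] [IsScalarTower K A A] [SMulCommClass K A A]
  [NonUnitalRing A'] [Module K A'] [IsScalarTower K A' A'] [SMulCommClass K A' A']

/-- The cochain `(u₁, …, u_{m+1}) ↦ ρ (f (u₁, …, u_m)) u_{m+1}`. -/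
def rhoCochain (P : MatchedPair K A A') {m : ℕ} (f : Cochain K A' A m) :
    Cochain K A' A' (m + 1) :=
  pairing P.ρ rfl f (idCochain K A')

/-- The cochain `(u₁, …, u_{m+1}) ↦ μ (f (u₂, …, u_{m+1})) u₁`. -/
def muCochain (P : MatchedPair K A A') {m : ℕ} (f : Cochain K A' A m) :
    Cochain K A' A' (m + 1) :=
  pairing P.μ.flip (Nat.add_comm m 1) (idCochain K A') f

/-- The bracket of `f₁ ∈ Hom(⊗^{m₁} A', A)` and `f₂ ∈ Hom(⊗^{m₂} A', A)`, an element of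
`Hom(⊗^{m₁+m₂} A', A)`. The index `i` of the sums is zero-based. -/
def bracket (P : MatchedPair K A A') {m₁ m₂ N : ℕ} (h : N = m₁ + m₂)
    (f₁ : Cochain K A' A m₁) (f₂ : Cochain K A' A m₂) : Cochain K A' A N :=
  pairing (LinearMap.mul K A) (h.trans (Nat.add_comm m₁ m₂)) f₂ f₁
  - (-1 : K) ^ (m₁ * m₂) • pairing (LinearMap.mul K A) h f₁ f₂
  + ∑ i : Fin m₁, (-1 : K) ^ (((i : ℕ) + 1) * m₂) • insertAt h i f₁ (P.muCochain f₂)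
  - ∑ i : Fin m₁, (-1 : K) ^ ((i : ℕ) * m₂) • insertAt h i f₁ (P.rhoCochain f₂)
  + (-1 : K) ^ (m₁ * m₂) • ∑ i : Fin m₂, (-1 : K) ^ ((i : ℕ) * m₁) •
      insertAt (h.trans (Nat.add_comm m₁ m₂)) i f₂ (P.rhoCochain f₁)
  - (-1 : K) ^ (m₁ * (m₂ + 1)) • ∑ i : Fin m₂, (-1 : K) ^ ((i : ℕ) * m₁) •
      insertAt (h.trans (Nat.add_comm m₁ m₂)) i f₂ (P.muCochain f₁)

/-- The differential of `f ∈ Hom(⊗^{n+1} A', A)`, with `m = n + 1` arguments, an element of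
`Hom(⊗^{n+2} A', A)`. The index `i` of the sum is zero-based. -/
def differential (P : MatchedPair K A A') {n : ℕ} (f : Cochain K A' A (n + 1)) :
    Cochain K A' A (n + 2) :=
  pairing P.ξ.flip rfl f (idCochain K A')
  + (-1 : K) ^ n • pairing P.η (Nat.add_comm (n + 1) 1) (idCochain K A') f
  + (-1 : K) ^ n • ∑ i : Fin (n + 1), (-1 : K) ^ ((i : ℕ) + 1) •
      insertAt rfl i f
        (pairing (LinearMap.mul K A') rfl (idCochain K A') (idCochain K A'))

/-- The vector space `⊕_{n ≥ 0} Hom(⊗^{n+1} A', A)`. -/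
abbrev ControlSpace (K A A' : Type*) [Field K]
    [NonUnitalRing A] [Module K A] [NonUnitalRing A'] [Module K A'] : Type _ :=
  DirectSum ℕ fun n => Cochain K A' A (n + 1)

/-- The grading of `s(⊕_{n ≥ 0} Hom(⊗^{n+1} A', A))`: before the shift `s`, the elements of
`Hom(⊗^{n+1} A', A)` have degree `n`, and the component of degree `i` of the shifted space is the
one of degree `i - 1` of the space itself. -/
def controlGrading (K A A' : Type*) [Field K]
    [NonUnitalRing A] [Module K A] [NonUnitalRing A'] [Module K A'] (i : ℤ) :
    Submodule K (ControlSpace K A A') where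
  carrier := {x | ∀ n : ℕ, (n : ℤ) ≠ i - 1 → x n = 0}
  add_mem' hx hy n hn := by simp [hx n hn, hy n hn]
  zero_mem' n _ := by simp
  smul_mem' c x hx n hn := by
    rw [DirectSum.smul_apply, hx n hn, smul_zero]

/-- `bracket` as a bilinear map. -/
def bracketHom (P : MatchedPair K A A') {m₁ m₂ N : ℕ} (h : N = m₁ + m₂) :
    Cochain K A' A m₁ →ₗ[K] Cochain K A' A m₂ →ₗ[K] Cochain K A' A N :=
  LinearMap.mk₂ K (fun f₁ f₂ => P.bracket h f₁ f₂)
    (fun f f' g => by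
      simp only [bracket, rhoCochain, muCochain, pairing_add_left, pairing_add_right,
        insertAt_add_left, insertAt_add_right, smul_add, Finset.sum_add_distrib]
      abel)
    (fun c f g => by
      simp only [bracket, rhoCochain, muCochain, pairing_smul_left, pairing_smul_right,
        insertAt_smul_left, insertAt_smul_right, smul_add, smul_sub, Finset.smul_sum,
        smul_comm c])
    (fun f g g' => by
      simp only [bracket, rhoCochain, muCochain, pairing_add_left, pairing_add_right,
        insertAt_add_left, insertAt_add_right, smul_add, Finset.sum_add_distrib]
      abel)
    (fun c f g => by
      simp only [bracket, rhoCochain, muCochain, pairing_smul_left, pairing_smul_right,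
        insertAt_smul_left, insertAt_smul_right, smul_add, smul_sub, Finset.smul_sum,
        smul_comm c])

/-- `differential` as a linear map. -/
def differentialHom (P : MatchedPair K A A') (n : ℕ) :
    Cochain K A' A (n + 1) →ₗ[K] Cochain K A' A (n + 2) where
  toFun f := P.differential f
  map_add' f f' := by
    simp only [differential, pairing_add_left, pairing_add_right, insertAt_add_left, smul_add,
      Finset.sum_add_distrib]
    abel
  map_smul' c f := by
    simp only [differential, pairing_smul_left, pairing_smul_right, insertAt_smul_left, smul_add,
      Finset.smul_sum, smul_comm c, RingHom.id_apply]

/-- The bilinear extension of `bracket` to the direct sum. -/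
def controlBracket (P : MatchedPair K A A') :
    ControlSpace K A A' →ₗ[K] ControlSpace K A A' →ₗ[K] ControlSpace K A A' :=
  DirectSum.toModule K ℕ _ fun p => LinearMap.flip <| DirectSum.toModule K ℕ _ fun q =>
    LinearMap.flip <| (P.bracketHom (N := p + q + 1 + 1) (by omega)).compr₂
      (DirectSum.lof K ℕ (fun n => Cochain K A' A (n + 1)) (p + q + 1))

/-- The linear extension of `differential` to the direct sum. -/
def controlDifferential (P : MatchedPair K A A') :
    ControlSpace K A A' →ₗ[K] ControlSpace K A A' :=
  DirectSum.toModule K ℕ _ fun n =>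
    DirectSum.lof K ℕ (fun n => Cochain K A' A (n + 1)) (n + 1) ∘ₗ P.differentialHom n

/-- A linear map `A' → A`, as an element of the summand `Hom(⊗¹ A', A)`. -/
def ofLinearMap (B : A' →ₗ[K] A) : ControlSpace K A A' :=
  DirectSum.lof K ℕ (fun n => Cochain K A' A (n + 1)) 0
    (MultilinearMap.ofSubsingleton K A' A (0 : Fin 1) B : Cochain K A' A 1)

end MatchedPair

/-!
Write `f ∘ Z` for the alternating sum of the insertions of `Z` into the entries of `f`. Functions on
lists over `A'` with values in the bicrossed product `A ⋈ A'` carry the first order operators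
`w ↦ φ ∪ w + w ∘ Z`, which are determined by their symbols `(φ, Z)` and closed under graded
commutators because `∪` is associative, `∘` is pre-Lie and `w ↦ w ∘ Z` is a derivation of `∪`.

Let `D` be the symbol of degree `1` formed by the inclusion `A' → A ⋈ A'` and the negative of the
product of `A'`; its operator squares to zero. A cochain `f` with values in `A` is the multiplier of
exactly one symbol whose bracket with `D` has an `A`-valued multiplier: its field is
`± μ(f(…))u - ρ(f(…))u`. The symbols with this property are closed under the bracket and under
`[D, ·]`, and these two operations restrict to the bracket and the differential of cochains. So the
axioms of a differential graded Lie algebra follow from those of the graded commutator and from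
`D² = 0`. On `Hom(A', A)` the bracket `⟦B, B⟧` has an overall factor `2`, and cancelling it turns
the Maurer–Cartan equation into the one for deformation maps.
-/

/-! ### The circle product of functions on lists -/

section ListCalculus

variable (K : Type*) [CommRing K] {V W X Y Z : Type*} [AddCommGroup W] [Module K W]
  [AddCommGroup X] [Module K X] [AddCommGroup Y] [Module K Y] [AddCommGroup Z] [Module K Z]

/-- A function on lists has arity `m` if it vanishes on lists of length different from `m`; the
homogeneous cochains with `m` arguments are encoded in this way, so that degrees are propositional
and no casts between types of cochains occur. -/
def HasArity {V W : Type*} [Zero W] (m : ℕ) (f : List V → W) : Prop :=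
  ∀ l : List V, l.length ≠ m → f l = 0

theorem HasArity.cons {V W : Type*} [Zero W] {m : ℕ} {f : List V → W} (hf : HasArity (m + 1) f)
    (u : V) : HasArity m fun l => f (u :: l) :=
  fun l hl => hf (u :: l) (by simpa using hl)

theorem HasArity.compLeft {m : ℕ} {f : List V → W} (hf : HasArity m f) (φ : W →ₗ[K] X) :
    HasArity m (φ.compLeft _ f) :=
  fun l hl => by simp [hf l hl]

theorem HasArity.sub_smul {m : ℕ} {f g : List V → W} (hf : HasArity m f) (hg : HasArity m g)
    (c : K) : HasArity m (f - c • g) :=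
  fun l hl => by simp [hf l hl, hg l hl]

variable {K}

/-- The product of functions on lists induced by a bilinear map, the first factor taking `m`
arguments. -/
def listCup (b : X →ₗ[K] Y →ₗ[K] Z) (m : ℕ) :
    (List V → X) →ₗ[K] (List V → Y) →ₗ[K] (List V → Z) :=
  LinearMap.mk₂ K (fun f g l => b (f (l.take m)) (g (l.drop m)))
    (fun _ _ _ => by ext; simp) (fun _ _ _ => by ext; simp)
    (fun _ _ _ => by ext; simp) (fun _ _ _ => by ext; simp)

theorem listCup_apply (b : X →ₗ[K] Y →ₗ[K] Z) (m : ℕ) (f : List V → X) (g : List V → Y)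
    (l : List V) : listCup b m f g l = b (f (l.take m)) (g (l.drop m)) := rfl

theorem listCup_assoc {b : X →ₗ[K] X →ₗ[K] X} (hb : ∀ x y z, b (b x y) z = b x (b y z))
    (m n : ℕ) (f g h : List V → X) :
    listCup b (m + n) (listCup b m f g) h = listCup b m f (listCup b n g h) := by
  ext l
  simp [listCup_apply, hb, List.take_take, List.drop_take]

variable (K)

/-- The value at a list of the circle product `listCirc` with `g`. -/
def listCircAt (W : Type*) [AddCommGroup W] [Module K W] (k : ℕ) (g : List V → V) :
    List V → (List V → W) →ₗ[K] W
  | [] => 0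
  | u :: l => LinearMap.proj (g (u :: l.take k) :: l.drop k) +
      (-1 : K) ^ k • (listCircAt W k g l ∘ₗ LinearMap.funLeft K W (List.cons u))

/-- The circle product `f ↦ f ∘ g = ∑ᵢ (-1)^(i k) f ∘ᵢ g`, which inserts a function `g` with
`k + 1` arguments, of degree `k`, into the entries of `f`. -/
def listCirc (k : ℕ) (g : List V → V) : (List V → W) →ₗ[K] (List V → W) :=
  LinearMap.pi (listCircAt K W k g)

theorem listCirc_nil (k : ℕ) (g : List V → V) (f : List V → W) : listCirc K k g f [] = 0 := rfl

theorem listCirc_cons (k : ℕ) (g : List V → V) (f : List V → W) (u : V) (l : List V) :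
    listCirc K k g f (u :: l) = f (g (u :: l.take k) :: l.drop k) +
      (-1 : K) ^ k • listCirc K k g (fun c => f (u :: c)) l := rfl

theorem listCirc_of_hasArity_zero (k : ℕ) (g : List V → V) {f : List V → W} (hf : HasArity 0 f) :
    listCirc K k g f = 0 := by
  ext l
  induction l generalizing f with
  | nil => rfl
  | cons u l ih =>
    rw [listCirc_cons, ih fun c _ => hf _ (by simp), hf _ (by simp)]
    simp

variable {K}

theorem listCirc_compLeft (k : ℕ) (g : List V → V) (φ : W →ₗ[K] X) (f : List V → W) :
    listCirc K k g (φ.compLeft _ f) = φ.compLeft _ (listCirc K k g f) := by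
  ext l
  induction l generalizing f with
  | nil => simp [listCirc_nil]
  | cons u l ih =>
    have := ih fun c => f (u :: c)
    simp only [LinearMap.compLeft_apply, Function.comp_apply] at this
    simp only [listCirc_cons, LinearMap.compLeft_apply, Function.comp_apply, map_add, map_smul,
      ← this]
    rfl

/-- The Leibniz rule. The second factor `F (g _)` depends on the value of the first one in an
arbitrary linear way, so that this covers bilinear products as well as the circle product itself. -/
theorem listCirc_bind (k m : ℕ) (h : List V → V) {g : List V → X} (hg : HasArity m g)
    (F : X →ₗ[K] (List V → W)) (l : List V) :
    listCirc K k h (fun l => F (g (l.take m)) (l.drop m)) l =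
      F (listCirc K k h g (l.take (m + k))) (l.drop (m + k)) +
        (-1 : K) ^ (m * k) • listCirc K k h (F (g (l.take m))) (l.drop m) := by
  induction l generalizing m g with
  | nil => simp [listCirc_nil]
  | cons u l ih =>
    cases m with
    | zero => simp [listCirc_of_hasArity_zero K k h hg]
    | succ m =>
      simp only [listCirc_cons, List.take_succ_cons, List.drop_succ_cons, ih m (hg.cons u),
        show m + 1 + k = (m + k) + 1 by omega, map_add, map_smul, Pi.add_apply, Pi.smul_apply,
        List.take_take, List.drop_take, List.drop_drop, smul_add, smul_smul, ← pow_add]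
      rw [show min k (m + k) = k by omega, show m + k - k = m by omega,
        show k + m * k = (m + 1) * k by ring, Nat.add_comm k m]
      abel

theorem listCirc_cup (b : X →ₗ[K] Y →ₗ[K] Z) (k m : ℕ) (h : List V → V) {f : List V → X}
    (hf : HasArity m f) (g : List V → Y) :
    listCirc K k h (listCup b m f g) =
      listCup b (m + k) (listCirc K k h f) g +
        (-1 : K) ^ (m * k) • listCup b m f (listCirc K k h g) := by
  ext l
  let F : X →ₗ[K] (List V → Z) := LinearMap.pi fun c => b.flip (g c)
  have leibniz := listCirc_bind k m h hf F l
  have second_factor : listCirc K k h (F (f (l.take m))) (l.drop m) =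
      b (f (l.take m)) (listCirc K k h g (l.drop m)) :=
    congrFun (listCirc_compLeft k h (b (f (l.take m))) g) _
  rw [second_factor] at leibniz
  exact leibniz

variable [AddCommGroup V] [Module K V]

variable (K) in
/-- A function on lists is multilinear if it is linear in every entry. -/
def ListMultilinear (f : List V → W) : Prop :=
  ∀ a b : List V, IsLinearMap K fun x => f (a ++ x :: b)

namespace ListMultilinear

variable {f : List V → W} (hf : ListMultilinear K f)
include hf

theorem cons (u : V) : ListMultilinear K fun l => f (u :: l) := fun a b => hf (u :: a) b

theorem map_zero (a b : List V) : f (a ++ 0 :: b) = 0 := (hf a b).map_zero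

theorem compLeft (φ : W →ₗ[K] X) : ListMultilinear K (φ.compLeft _ f) :=
  fun a b => (φ ∘ₗ (hf a b).mk').isLinear

/-- A multilinear function on lists, curried in its first entry. -/
def headMap : V →ₗ[K] (List V → W) :=
  LinearMap.pi fun c => (hf [] c).mk'

theorem headMap_apply (x : V) (c : List V) : hf.headMap x c = f (x :: c) := rfl

/-- The circle product `f ∘ g` with a multilinear `f`, as a linear map in `g`. -/
def circHom (k : ℕ) : (List V → V) →ₗ[K] (List V → W) :=
  have map_add_smul (c c' : K) (g h : List V → V) :
      listCirc K k (c • g + c' • h) f = c • listCirc K k g f + c' • listCirc K k h f := by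
    ext l
    induction l generalizing f with
    | nil => simp [listCirc_nil]
    | cons u l ih =>
      have := ih (hf.cons u)
      simp only [Pi.add_apply, Pi.smul_apply] at this ⊢
      simp only [listCirc_cons, Pi.add_apply, Pi.smul_apply, this]
      simp only [← hf.headMap_apply, map_add, map_smul, Pi.add_apply, Pi.smul_apply]
      module
  { toFun g := listCirc K k g f
    map_add' g h := by simpa using map_add_smul 1 1 g h
    map_smul' c g := by simpa using map_add_smul c 0 g 0 }

theorem circHom_apply (k : ℕ) (g : List V → V) : hf.circHom k g = listCirc K k g f := rfl

end ListMultilinear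

theorem HasArity.listCirc {m k : ℕ} {g : List V → V} (hg : HasArity (k + 1) g)
    {f : List V → W} (hf : HasArity m f) (hf' : ListMultilinear K f) :
    HasArity (m + k) (listCirc K k g f) := by
  intro l hl
  induction l generalizing m f with
  | nil => rfl
  | cons u l ih =>
    cases m with
    | zero => rw [listCirc_of_hasArity_zero K k g hf, Pi.zero_apply]
    | succ m =>
      simp only [List.length_cons] at hl
      rw [listCirc_cons, ih (hf.cons u) (hf'.cons u) (by omega), smul_zero, add_zero]
      by_cases hk : k ≤ l.length
      · exact hf _ (by simp; omega)
      · rw [hg _ (by simp; omega)]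
        exact hf'.map_zero [] _

theorem listCirc_eq_sum (k : ℕ) {g : List V → V} (hg : g [] = 0) {m : ℕ} {f : List V → W}
    (hf : HasArity m f) (hf' : ListMultilinear K f) (l : List V) :
    listCirc K k g f l = ∑ i : Fin m, (-1 : K) ^ ((i : ℕ) * k) •
      f (l.take i ++ g ((l.drop i).take (k + 1)) :: l.drop (i + k + 1)) := by
  induction l generalizing m f with
  | nil =>
    have vanish : f [0] = 0 := hf'.map_zero [] []
    simp [listCirc_nil, hg, vanish]
  | cons u l ih =>
    cases m with
    | zero => simp [listCirc_of_hasArity_zero K k g hf]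
    | succ m =>
      rw [Fin.sum_univ_succ, listCirc_cons, ih (hf.cons u) (hf'.cons u), Finset.smul_sum]
      congr 1
      · simp
      · refine Finset.sum_congr rfl fun i _ => ?_
        rw [smul_smul, ← pow_add, Fin.val_succ, show k + i * k = (i + 1) * k by ring,
          show (i : ℕ) + 1 + k + 1 = (i + k + 1) + 1 by omega]
        rfl

/-- By the Leibniz rule the terms inserting `h` into an inserted `g` cancel; those that remain
insert `g` and `h` at distinct places of `f`, whence the graded symmetry in `g` and `h`. -/
theorem listCirc_associator_cons (k k' : ℕ) {g : List V → V} (h : List V → V)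
    (hg : HasArity (k + 1) g) {f : List V → W} (hf : ListMultilinear K f) (u : V) (l : List V) :
    listCirc K k' h (listCirc K k g f) (u :: l) -
        listCirc K (k + k') (listCirc K k' h g) f (u :: l) =
      (-1 : K) ^ k • listCirc K k g (fun c => f (h (u :: l.take k') :: c)) (l.drop k') +
        (-1 : K) ^ (k' + k * k') •
          listCirc K k' h (fun c => f (g (u :: l.take k) :: c)) (l.drop k) +
        (-1 : K) ^ (k + k') •
          (listCirc K k' h (listCirc K k g fun c => f (u :: c)) l -
            listCirc K (k + k') (listCirc K k' h g) (fun c => f (u :: c)) l) := by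
  have head_split : (fun c => listCirc K k g f (u :: c)) =
      (fun l => hf.headMap (g (u :: l.take k)) (l.drop k)) +
        (-1 : K) ^ k • listCirc K k g fun c => f (u :: c) := rfl
  rw [listCirc_cons K k', head_split, map_add, map_smul, Pi.add_apply,
    listCirc_bind k' k h (hg.cons u) hf.headMap l, listCirc_cons K k, listCirc_cons K (k + k'),
    listCirc_cons K k', ← hf.headMap_apply (_ + _), map_add, map_smul]
  simp only [List.take_take, List.drop_take, List.drop_drop, Pi.add_apply, Pi.smul_apply,
    show min k' (k + k') = k' by omega, show k + k' - k' = k by omega, Nat.add_comm k' k,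
    hf.headMap_apply, show hf.headMap = fun x c => f (x :: c) from rfl, smul_add, smul_sub,
    smul_smul, ← pow_add]
  abel

theorem listCirc_preLie (k k' : ℕ) {g h : List V → V} (hg : HasArity (k + 1) g)
    (hh : HasArity (k' + 1) h) {f : List V → W} (hf : ListMultilinear K f) :
    listCirc K k' h (listCirc K k g f) - listCirc K (k + k') (listCirc K k' h g) f =
      (-1 : K) ^ (k * k') •
        (listCirc K k g (listCirc K k' h f) - listCirc K (k + k') (listCirc K k g h) f) := by
  ext l
  induction l generalizing f with
  | nil => simp [listCirc_nil]
  | cons u l ih =>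
    have ih := ih (hf.cons u)
    simp only [Pi.sub_apply, Pi.smul_apply] at ih ⊢
    rw [listCirc_associator_cons k k' h hg hf, ih, Nat.add_comm k k',
      listCirc_associator_cons k' k g hh hf, Nat.mul_comm k' k, Nat.add_comm k' k]
    rcases neg_one_pow_eq_or K k with e | e <;> rcases neg_one_pow_eq_or K k' with e' | e' <;>
      rcases neg_one_pow_eq_or K (k * k') with e'' | e'' <;>
      simp only [pow_add, e, e', e''] <;> module

/-- In characteristic two this does not follow from `listCirc_preLie`. -/
theorem listCirc_listCirc_self {k : ℕ} (hk : Odd k) {g : List V → V} (hg : HasArity (k + 1) g)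
    {f : List V → W} (hf : ListMultilinear K f) :
    listCirc K k g (listCirc K k g f) = listCirc K (k + k) (listCirc K k g g) f := by
  ext l
  induction l generalizing f with
  | nil => rfl
  | cons u l ih =>
    rw [← sub_eq_zero, listCirc_associator_cons k k g hg hf, ih (hf.cons u), sub_self, smul_zero,
      add_zero, hk.neg_one_pow, (hk.add_odd (hk.mul hk)).neg_one_pow]
    module

end ListCalculus

/-! ### First order operators -/

section Symbols

/-- The symbol `(φ, Z)` of the first order operator `w ↦ φ ∪ w + w ∘ Z` on functions on lists, which
consists of the multiplication by `φ` and of the derivation along the vector field `Z`. -/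
@[ext]
structure ListSymbol (V X : Type*) where
  multiplier : List V → X
  field : List V → V

namespace ListSymbol

variable {K : Type*} [CommRing K] {V X : Type*} [AddCommGroup X] [Module K X]

/-- The first order operator with symbol `p` of degree `m`, where `b` multiplies the values. -/
def op (b : X →ₗ[K] X →ₗ[K] X) (m : ℕ) (p : ListSymbol V X) :
    (List V → X) →ₗ[K] (List V → X) :=
  listCup b m p.multiplier + listCirc K m p.field

theorem op_apply (b : X →ₗ[K] X →ₗ[K] X) (m : ℕ) (p : ListSymbol V X) (w : List V → X) :
    p.op b m w = listCup b m p.multiplier w + listCirc K m p.field w := rfl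

theorem op_op {b : X →ₗ[K] X →ₗ[K] X} (hb : ∀ x y z, b (b x y) z = b x (b y z)) {m n : ℕ}
    (p : ListSymbol V X) {q : ListSymbol V X} (hq : HasArity n q.multiplier) (w : List V → X) :
    p.op b m (q.op b n w) =
      listCup b (m + n) (p.op b m q.multiplier) w +
        listCup b m p.multiplier (listCirc K n q.field w) +
        (-1 : K) ^ (n * m) • listCup b n q.multiplier (listCirc K m p.field w) +
        listCirc K m p.field (listCirc K n q.field w) := by
  simp only [op_apply, map_add, LinearMap.add_apply, listCup_assoc hb, listCirc_cup _ _ _ _ hq,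
    Nat.add_comm n m]
  module

variable [AddCommGroup V] [Module K V]

/-- The bracket of symbols of degrees `m` and `n`. Its operator is the graded commutator
for the opposite composition, see `op_bracket`, since `w ↦ w ∘ Z` is a right multiplication. -/
def bracket (b : X →ₗ[K] X →ₗ[K] X) (m n : ℕ) (p q : ListSymbol V X) : ListSymbol V X where
  multiplier := q.op b n p.multiplier - (-1 : K) ^ (m * n) • p.op b m q.multiplier
  field := listCirc K n q.field p.field - (-1 : K) ^ (m * n) • listCirc K m p.field q.field

theorem bracket_multiplier_skew (b : X →ₗ[K] X →ₗ[K] X) (m n : ℕ) (p q : ListSymbol V X) :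
    (bracket b m n p q).multiplier = -((-1 : K) ^ (m * n) • (bracket b n m q p).multiplier) := by
  simp only [bracket, Nat.mul_comm n m, smul_sub, smul_smul, ← mul_pow, mul_neg, mul_one, neg_neg,
    one_pow, one_smul, neg_sub]

variable (K) in
/-- A symbol has degree `m` if its operator sends functions of arity `n` to functions of arity
`m + n`. -/
structure IsHomogeneous (m : ℕ) (p : ListSymbol V X) : Prop where
  multiplier_arity : HasArity m p.multiplier
  multiplier_linear : ListMultilinear K p.multiplier
  field_arity : HasArity (m + 1) p.field
  field_linear : ListMultilinear K p.field

variable {b : X →ₗ[K] X →ₗ[K] X} {m n r : ℕ} {p q s : ListSymbol V X} {w : List V → X}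

theorem bracket_field_arity (hp : p.IsHomogeneous K m) (hq : q.IsHomogeneous K n) :
    HasArity (m + n + 1) (bracket b m n p q).field := by
  have hpq := hq.field_arity.listCirc hp.field_arity hp.field_linear
  have hqp := hp.field_arity.listCirc hq.field_arity hq.field_linear
  rw [show m + 1 + n = m + n + 1 by omega] at hpq
  rw [show n + 1 + m = m + n + 1 by omega] at hqp
  exact hpq.sub_smul K hqp _

variable (hb : ∀ x y z, b (b x y) z = b x (b y z))
include hb

theorem op_bracket (hp : p.IsHomogeneous K m) (hq : q.IsHomogeneous K n)
    (hw : ListMultilinear K w) :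
    (bracket b m n p q).op b (m + n) w =
      q.op b n (p.op b m w) - (-1 : K) ^ (m * n) • p.op b m (q.op b n w) := by
  have preLie := listCirc_preLie m n hp.field_arity hq.field_arity hw
  rw [sub_eq_iff_eq_add] at preLie
  have circ_field : listCirc K (m + n) (bracket b m n p q).field w =
      listCirc K (m + n) (listCirc K n q.field p.field) w -
        (-1 : K) ^ (m * n) • listCirc K (m + n) (listCirc K m p.field q.field) w := by
    simp only [← hw.circHom_apply, bracket, map_sub, map_smul]
  rw [op_op hb _ hp.multiplier_arity, op_op hb _ hq.multiplier_arity, preLie, op_apply, circ_field]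
  simp only [bracket, map_sub, map_smul, LinearMap.sub_apply, LinearMap.smul_apply,
    Nat.add_comm n m, Nat.mul_comm n m]
  rcases neg_one_pow_eq_or K (m * n) with e | e <;> rw [e] <;> module

theorem bracket_multiplier_jacobi (hp : p.IsHomogeneous K m) (hq : q.IsHomogeneous K n)
    (hs : s.IsHomogeneous K r) :
    (bracket b m (n + r) p (bracket b n r q s)).multiplier =
      (bracket b (m + n) r (bracket b m n p q) s).multiplier +
        (-1 : K) ^ (m * n) • (bracket b n (m + r) q (bracket b m r p s)).multiplier := by
  have unfold_multiplier (m n : ℕ) (p q : ListSymbol V X) : (bracket b m n p q).multiplier =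
    q.op b n p.multiplier - (-1 : K) ^ (m * n) • p.op b m q.multiplier := rfl
  simp only [unfold_multiplier m (n + r), unfold_multiplier (m + n) r, unfold_multiplier n (m + r),
    op_bracket hb hq hs hp.multiplier_linear, op_bracket hb hp hs hq.multiplier_linear,
    op_bracket hb hp hq hs.multiplier_linear]
  simp only [bracket, map_sub, map_smul, Nat.mul_add, Nat.add_mul, pow_add, Nat.mul_comm n m]
  rcases neg_one_pow_eq_or K (m * n) with e | e <;>
    rcases neg_one_pow_eq_or K (m * r) with e' | e' <;>
    rcases neg_one_pow_eq_or K (n * r) with e'' | e'' <;> simp only [e, e', e''] <;> module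

variable (hm : Odd m) (hp : p.IsHomogeneous K m) (hφ : p.op b m p.multiplier = 0)
  (hZ : listCirc K m p.field p.field = 0)
include hm hp hφ hZ

theorem op_op_self_eq_zero (hw : ListMultilinear K w) : p.op b m (p.op b m w) = 0 := by
  have circ_square : listCirc K m p.field (listCirc K m p.field w) = 0 := by
    rw [listCirc_listCirc_self hm hp.field_arity hw, hZ, ← hw.circHom_apply, map_zero]
  rw [op_op hb _ hp.multiplier_arity, hφ, circ_square, map_zero, (hm.mul hm).neg_one_pow,
    LinearMap.zero_apply]
  module

theorem bracket_bracket_self_multiplier (hq : q.IsHomogeneous K n) :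
    (bracket b m (m + n) p (bracket b m n p q)).multiplier = 0 := by
  have op_pq := op_bracket hb hp hq hp.multiplier_linear
  rw [hφ, map_zero] at op_pq
  have square := op_op_self_eq_zero hb hm hp hφ hZ hq.multiplier_linear
  rw [bracket, op_pq]
  simp only [bracket, map_sub, map_smul, square, Nat.mul_add, pow_add, (hm.mul hm).neg_one_pow]
  module

end ListSymbol

end Symbols

/-! ### Cochains as functions on lists -/

section Cochains

variable {K V W X Y : Type*} [Field K] [AddCommGroup V] [Module K V] [AddCommGroup W] [Module K W]
  [AddCommGroup X] [Module K X] [AddCommGroup Y] [Module K Y]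

/-- A cochain as a function on lists, extended by zero to lists of the wrong length. -/
def evalList {m : ℕ} : Cochain K V W m →ₗ[K] (List V → W) where
  toFun f l := if h : l.length = m then f fun i => l[(i : ℕ)] else 0
  map_add' f g := by ext l; by_cases h : l.length = m <;> simp [h]
  map_smul' c f := by ext l; by_cases h : l.length = m <;> simp [h]

theorem evalList_apply {m : ℕ} (f : Cochain K V W m) {l : List V} (h : l.length = m) :
    evalList f l = f fun i => l[(i : ℕ)] := dif_pos h

theorem hasArity_evalList {m : ℕ} (f : Cochain K V W m) : HasArity m (evalList f) :=
  fun _ h => dif_neg h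

theorem evalList_ofFn {m : ℕ} (f : Cochain K V W m) (u : Fin m → V) :
    evalList f (List.ofFn u) = f u := by
  rw [evalList_apply f (by simp)]
  simp

theorem listMultilinear_evalList {m : ℕ} (f : Cochain K V W m) :
    ListMultilinear K (evalList f) := by
  intro a b
  by_cases hm : m = a.length + 1 + b.length
  · let u : Fin m → V := fun i => (a ++ (0 : V) :: b)[(i : ℕ)]'(by simp; omega)
    have eval_update (z : V) :
        evalList f (a ++ z :: b) = f.toLinearMap u ⟨a.length, by omega⟩ z := by
      rw [evalList_apply f (by simp; omega), MultilinearMap.toLinearMap_apply]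
      congr 1
      funext i
      simp only [u, Function.update_apply, Fin.ext_iff, List.getElem_append, List.getElem_cons]
      split_ifs <;> first | rfl | omega
    simp only [eval_update]
    exact LinearMap.isLinear _
  · simp only [hasArity_evalList f (a ++ _ :: b) (by simp; omega)]
    exact (0 : V →ₗ[K] W).isLinear

theorem evalList_pairing (b : W →ₗ[K] X →ₗ[K] Y) {m n N : ℕ} (h : N = m + n)
    (f : Cochain K V W m) (g : Cochain K V X n) :
    evalList (pairing b h f g) = listCup b m (evalList f) (evalList g) := by
  ext l
  rw [listCup_apply]
  by_cases hl : l.length = N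
  · rw [evalList_apply _ hl, evalList_apply f (by simp; omega), evalList_apply g (by simp; omega)]
    simp [pairing]
  · rw [hasArity_evalList _ _ hl]
    by_cases hm : m ≤ l.length
    · rw [hasArity_evalList g _ (by simp; omega), map_zero]
    · rw [hasArity_evalList f _ (by simp; omega), map_zero, LinearMap.zero_apply]

theorem evalList_insertAt {m k N : ℕ} (h : N = m + k) (i : Fin m)
    (f : Cochain K V W m) (g : Cochain K V V (k + 1)) (l : List V) :
    evalList (insertAt h i f g) l =
      evalList f (l.take i ++ evalList g ((l.drop i).take (k + 1)) :: l.drop (i + k + 1)) := by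
  by_cases hl : l.length = N
  · rw [evalList_apply _ hl, evalList_apply g (by simp; omega), evalList_apply f (by simp; omega)]
    change f _ = _
    congr 1
    funext j
    simp only [insertArgs, Function.update_apply, Fin.ext_iff, Fin.lt_def, List.getElem_append,
      List.getElem_cons, List.length_take, List.getElem_take, List.getElem_drop]
    split_ifs <;> first | rfl | omega | (congr 1; omega)
  · rw [hasArity_evalList _ _ hl]
    by_cases hg : ((l.drop i).take (k + 1)).length = k + 1
    · rw [hasArity_evalList f]
      simp only [List.length_append, List.length_cons, List.length_take,
        List.length_drop] at hg ⊢
      omega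
    · rw [hasArity_evalList g _ hg, (listMultilinear_evalList f).map_zero]

theorem evalList_sum_insertAt {m k N : ℕ} (h : N = m + k)
    (f : Cochain K V W m) (g : Cochain K V V (k + 1)) :
    evalList (∑ i : Fin m, (-1 : K) ^ ((i : ℕ) * k) • insertAt h i f g) =
      listCirc K k (evalList g) (evalList f) := by
  ext l
  rw [listCirc_eq_sum k (hasArity_evalList g _ (by simp)) (hasArity_evalList f)
    (listMultilinear_evalList f)]
  simp only [map_sum, map_smul, Finset.sum_apply, Pi.smul_apply, evalList_insertAt]

theorem listCirc_idCochain (k : ℕ) {g : List V → V} (hg : HasArity (k + 1) g) :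
    listCirc K k g (evalList (idCochain K V)) = g := by
  ext l
  cases l with
  | nil => rw [listCirc_nil, hg _ (by simp)]
  | cons u l =>
    rw [listCirc_cons, listCirc_of_hasArity_zero K k g ((hasArity_evalList _).cons u)]
    simp only [Pi.zero_apply, smul_zero, add_zero]
    by_cases h : l.length ≤ k
    · rw [evalList_apply _ (by simp; omega), List.take_of_length_le h]
      rfl
    · rw [hasArity_evalList _ _ (by simp; omega), hg _ (by simp; omega)]

end Cochains

/-! ### The symbol of a cochain -/

section LeftValued

variable (K : Type*) [CommRing K] {V W X : Type*} [AddCommGroup W] [Module K W]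
  [AddCommGroup X] [Module K X]

/-- Functions on lists with values in `W`, as functions with values in `W × X`. -/
def listInl : (List V → W) →ₗ[K] (List V → W × X) := (LinearMap.inl K W X).compLeft _

/-- Functions on lists with values in `X`, as functions with values in `W × X`. -/
def listInr : (List V → X) →ₗ[K] (List V → W × X) := (LinearMap.inr K W X).compLeft _

theorem listInl_apply (f : List V → W) (l : List V) : listInl K (X := X) f l = (f l, 0) := rfl

theorem listInr_apply (f : List V → X) (l : List V) : listInr K (W := W) f l = (0, f l) := rfl

/-- The functions on lists with values in `W × X` whose values lie in `W`. -/
def leftValued (V W X : Type*) [AddCommGroup W] [Module K W] [AddCommGroup X] [Module K X] :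
    Submodule K (List V → W × X) :=
  LinearMap.ker ((LinearMap.snd K W X).compLeft (List V))

variable {K}

theorem mem_leftValued_iff {f : List V → W × X} : f ∈ leftValued K V W X ↔ ∀ l, (f l).2 = 0 :=
  funext_iff

theorem listInl_mem_leftValued (f : List V → W) : listInl K f ∈ leftValued K V W X :=
  mem_leftValued_iff.mpr fun _ => rfl

theorem eq_zero_of_listInr_mem_leftValued {f : List V → X}
    (hf : listInr K f ∈ leftValued K V W X) : f = 0 :=
  funext (mem_leftValued_iff.mp hf)

theorem listCirc_mem_leftValued (k : ℕ) (g : List V → V) {f : List V → W × X}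
    (hf : f ∈ leftValued K V W X) : listCirc K k g f ∈ leftValued K V W X := by
  rw [leftValued, LinearMap.mem_ker] at hf ⊢
  rw [← listCirc_compLeft, hf, map_zero]

end LeftValued

section Inclusion

variable (K W V : Type*) [Field K] [AddCommGroup W] [Module K W] [AddCommGroup V] [Module K V]

/-- The inclusion of `V` in `W × V`, as a function on lists. -/
def listIncl : List V → W × V := listInr K (evalList (idCochain K V))

theorem hasArity_listIncl : HasArity 1 (listIncl K W V) := (hasArity_evalList _).compLeft K _

variable {K W V}

theorem listCirc_listIncl (k : ℕ) {g : List V → V} (hg : HasArity (k + 1) g) :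
    listCirc K k g (listIncl K W V) = listInr K g := by
  rw [listIncl, listInr, listCirc_compLeft, listCirc_idCochain k hg]

end Inclusion

namespace MatchedPair

open ListSymbol

variable {K A A' : Type*} [Field K] [NonUnitalRing A] [Module K A] [NonUnitalRing A'] [Module K A']
  (P : MatchedPair K A A')

/-- The symbol of a cochain `f`: the multiplication by `f` in `A ⋈ A'` together with the vector
field that makes the bracket with `baseSymbol` take its values in `A`. -/
def symbol {m : ℕ} (f : Cochain K A' A m) : ListSymbol A' (A × A') where
  multiplier := listInl K (evalList f)
  field := evalList ((-1 : K) ^ m • P.muCochain f - P.rhoCochain f)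

theorem symbol_isHomogeneous {m : ℕ} (f : Cochain K A' A m) : (P.symbol f).IsHomogeneous K m where
  multiplier_arity := (hasArity_evalList f).compLeft K _
  multiplier_linear := (listMultilinear_evalList f).compLeft _
  field_arity := hasArity_evalList _
  field_linear := listMultilinear_evalList _

theorem listCirc_symbol_field {m n N : ℕ} (h : N = n + m) (f : Cochain K A' A m)
    (g : Cochain K A' A n) :
    listCirc K m (P.symbol f).field (evalList g) =
      evalList ((-1 : K) ^ m • ∑ i : Fin n, (-1 : K) ^ ((i : ℕ) * m) •
          insertAt h i g (P.muCochain f) -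
        ∑ i : Fin n, (-1 : K) ^ ((i : ℕ) * m) • insertAt h i g (P.rhoCochain f)) := by
  rw [map_sub, map_smul, evalList_sum_insertAt, evalList_sum_insertAt, symbol]
  simp only [← (listMultilinear_evalList g).circHom_apply, map_sub, map_smul]

variable [IsScalarTower K A' A'] [SMulCommClass K A' A']

variable (K A A') in
/-- The symbol of degree `1` whose adjoint action extends the differential; its field is the product
of `A'` up to sign. -/
def baseSymbol : ListSymbol A' (A × A') where
  multiplier := listIncl K A A'
  field := evalList (-pairing (LinearMap.mul K A') rfl (idCochain K A') (idCochain K A'))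

theorem baseSymbol_isHomogeneous : (baseSymbol K A A').IsHomogeneous K 1 where
  multiplier_arity := hasArity_listIncl K A A'
  multiplier_linear := (listMultilinear_evalList _).compLeft _
  field_arity := hasArity_evalList _
  field_linear := listMultilinear_evalList _

theorem baseSymbol_field : (baseSymbol K A A').field =
    -listCup (LinearMap.mul K A') 1 (evalList (idCochain K A')) (evalList (idCochain K A')) := by
  rw [baseSymbol, map_neg, evalList_pairing]

theorem listCirc_baseSymbol_field :
    listCirc K 1 (baseSymbol K A A').field (baseSymbol K A A').field = 0 := by
  have circ_id : listCirc K 1 (baseSymbol K A A').field (evalList (idCochain K A')) =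
      -listCup (LinearMap.mul K A') 1 (evalList (idCochain K A')) (evalList (idCochain K A')) := by
    rw [listCirc_idCochain 1 baseSymbol_isHomogeneous.field_arity, baseSymbol_field]
  nth_rw 2 [baseSymbol_field]
  rw [map_neg, listCirc_cup _ _ _ _ (hasArity_evalList _), circ_id]
  simp only [map_neg, LinearMap.neg_apply, listCup_assoc (b := LinearMap.mul K A') mul_assoc]
  module

variable [IsScalarTower K A A] [SMulCommClass K A A]

/-- The product of the bicrossed product `A ⋈ A'`, the algebra structure on `A × A'` for which `A`
and `A'` are subalgebras whose mutual products are given by the actions of the matched pair. -/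
def bicrossedMul : A × A' →ₗ[K] A × A' →ₗ[K] A × A' :=
  LinearMap.mk₂ K
    (fun a b => (a.1 * b.1 + P.ξ b.2 a.1 + P.η a.2 b.1, a.2 * b.2 + P.ρ a.1 b.2 + P.μ b.1 a.2))
    (fun a a' b => by ext <;> simp [add_mul] <;> abel)
    (fun c a b => by ext <;> simp [smul_mul_assoc])
    (fun a b b' => by ext <;> simp [mul_add] <;> abel)
    (fun c a b => by ext <;> simp [mul_smul_comm])

theorem bicrossedMul_apply (a b : A × A') : P.bicrossedMul a b =
    (a.1 * b.1 + P.ξ b.2 a.1 + P.η a.2 b.1, a.2 * b.2 + P.ρ a.1 b.2 + P.μ b.1 a.2) := rfl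

theorem bicrossedMul_assoc (a b c : A × A') :
    P.bicrossedMul (P.bicrossedMul a b) c = P.bicrossedMul a (P.bicrossedMul b c) := by
  have mid := eq_sub_of_add_eq (P.mid b.1 a.2 c.2)
  have mid' := eq_sub_of_add_eq (P.mid' b.2 a.1 c.1)
  have left_right := LinearMap.congr_fun (P.rep.left_right a.1 c.1) b.2
  have left_right' := LinearMap.congr_fun (P.rep'.left_right a.2 c.2) b.1
  simp only [LinearMap.comp_apply] at left_right left_right'
  simp only [bicrossedMul_apply, map_add, LinearMap.add_apply, mul_add, add_mul, P.ρ_mul, P.μ_mul,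
    P.η_mul, P.ξ_mul, P.rep.left_mul, P.rep.right_mul, P.rep'.left_mul, P.rep'.right_mul,
    LinearMap.comp_apply, mid, mid', left_right, left_right', mul_assoc]
  ext <;> simp only <;> abel

theorem listCup_bicrossedMul_mem_leftValued (m : ℕ) {f g : List A' → A × A'}
    (hf : f ∈ leftValued K A' A A') (hg : g ∈ leftValued K A' A A') :
    listCup P.bicrossedMul m f g ∈ leftValued K A' A A' := by
  rw [mem_leftValued_iff] at hf hg ⊢
  intro l
  simp [listCup_apply, bicrossedMul_apply, hf, hg]

theorem bracket_multiplier_mem_leftValued (m n : ℕ) {p q : ListSymbol A' (A × A')}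
    (hp : p.multiplier ∈ leftValued K A' A A') (hq : q.multiplier ∈ leftValued K A' A A') :
    (ListSymbol.bracket P.bicrossedMul m n p q).multiplier ∈ leftValued K A' A A' :=
  have op_mem {k : ℕ} {s : ListSymbol A' (A × A')} {w : List A' → A × A'}
      (hs : s.multiplier ∈ leftValued K A' A A') (hw : w ∈ leftValued K A' A A') :
      s.op P.bicrossedMul k w ∈ leftValued K A' A A' :=
    add_mem (P.listCup_bicrossedMul_mem_leftValued k hs hw) (listCirc_mem_leftValued k s.field hw)
  sub_mem (op_mem hq hp) (Submodule.smul_mem _ _ (op_mem hp hq))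

theorem listCup_listInl_listInl (m : ℕ) (f g : List A' → A) :
    listCup P.bicrossedMul m (listInl K f) (listInl K g) =
      listInl K (listCup (LinearMap.mul K A) m f g) := by
  ext l <;> simp [listInl_apply, listCup_apply, bicrossedMul_apply]

theorem listCup_listInr_listInr (m : ℕ) (f g : List A' → A') :
    listCup P.bicrossedMul m (listInr K f) (listInr K g) =
      listInr K (listCup (LinearMap.mul K A') m f g) := by
  ext l <;> simp [listInr_apply, listCup_apply, bicrossedMul_apply]

theorem listCup_listInl_listIncl {m : ℕ} (f : Cochain K A' A m) :
    listCup P.bicrossedMul m (listInl K (evalList f)) (listIncl K A A') =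
      listInl K (evalList (pairing P.ξ.flip rfl f (idCochain K A'))) +
        listInr K (evalList (P.rhoCochain f)) := by
  rw [rhoCochain, evalList_pairing, evalList_pairing]
  ext l <;> simp [listIncl, listInl_apply, listInr_apply, listCup_apply, bicrossedMul_apply]

theorem listCup_listIncl_listInl {m : ℕ} (f : Cochain K A' A m) :
    listCup P.bicrossedMul 1 (listIncl K A A') (listInl K (evalList f)) =
      listInl K (evalList (pairing P.η (Nat.add_comm m 1) (idCochain K A') f)) +
        listInr K (evalList (P.muCochain f)) := by
  rw [muCochain, evalList_pairing, evalList_pairing]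
  ext l <;> simp [listIncl, listInl_apply, listInr_apply, listCup_apply, bicrossedMul_apply]

theorem op_baseSymbol_multiplier :
    (baseSymbol K A A').op P.bicrossedMul 1 (baseSymbol K A A').multiplier = 0 := by
  have circ_incl : listCirc K 1 (baseSymbol K A A').field (listIncl K A A') =
      -listCup P.bicrossedMul 1 (listIncl K A A') (listIncl K A A') := by
    rw [listCirc_listIncl 1 baseSymbol_isHomogeneous.field_arity, baseSymbol_field, map_neg,
      listIncl, listCup_listInr_listInr]
  exact add_eq_zero_iff_eq_neg'.mpr circ_incl

theorem bracket_symbol_symbol_multiplier {m n N : ℕ} (h : N = m + n) (f : Cochain K A' A m)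
    (g : Cochain K A' A n) :
    (ListSymbol.bracket P.bicrossedMul m n (P.symbol f) (P.symbol g)).multiplier =
      listInl K (evalList (P.bracket h f g)) := by
  have op_symbol {m n N : ℕ} (h : N = m + n) (f : Cochain K A' A m) (g : Cochain K A' A n) :
      (P.symbol f).op P.bicrossedMul m (P.symbol g).multiplier =
        listInl K (evalList (pairing (LinearMap.mul K A) h f g) +
          listCirc K m (P.symbol f).field (evalList g)) := by
    rw [evalList_pairing, map_add, ← listCup_listInl_listInl, listInl, ← listCirc_compLeft]
    rfl
  have sign_succ (i : ℕ) : (-1 : K) ^ ((i + 1) * n) = (-1) ^ n * (-1) ^ (i * n) := by ring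
  rw [ListSymbol.bracket, op_symbol (h.trans (Nat.add_comm m n)), op_symbol h,
    P.listCirc_symbol_field h g f, P.listCirc_symbol_field (h.trans (Nat.add_comm m n)) f g]
  simp only [← map_add, ← map_smul, ← map_sub]
  congr 2
  simp only [MatchedPair.bracket, sign_succ, Nat.mul_add, Nat.mul_one, pow_add, mul_smul,
    ← Finset.smul_sum]
  module

theorem bracket_baseSymbol_symbol_multiplier {m : ℕ} (f : Cochain K A' A m) :
    (ListSymbol.bracket P.bicrossedMul 1 m (baseSymbol K A A') (P.symbol f)).multiplier =
      listInl K (evalList (pairing P.ξ.flip rfl f (idCochain K A')) -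
        (-1 : K) ^ m • (evalList (pairing P.η (Nat.add_comm m 1) (idCochain K A') f) +
          listCirc K 1 (baseSymbol K A A').field (evalList f))) := by
  have op_symbol : (P.symbol f).op P.bicrossedMul m (listIncl K A A') =
      listInl K (evalList (pairing P.ξ.flip rfl f (idCochain K A'))) +
        (-1 : K) ^ m • listInr K (evalList (P.muCochain f)) := by
    rw [op_apply, symbol, listCup_listInl_listIncl, listCirc_listIncl m (hasArity_evalList _)]
    simp only [map_sub, map_smul]
    module
  have op_base : (baseSymbol K A A').op P.bicrossedMul 1 (listInl K (evalList f)) =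
      listInl K (evalList (pairing P.η (Nat.add_comm m 1) (idCochain K A') f) +
        listCirc K 1 (baseSymbol K A A').field (evalList f)) +
          listInr K (evalList (P.muCochain f)) := by
    rw [op_apply, map_add, listInl, listCirc_compLeft, ← listInl]
    refine (congrArg (· + _) (P.listCup_listIncl_listInl f)).trans ?_
    abel
  change (P.symbol f).op _ m (listIncl K A A') -
    (-1 : K) ^ (1 * m) • (baseSymbol K A A').op _ 1 (listInl K (evalList f)) = _
  rw [op_symbol, op_base, one_mul]
  simp only [map_sub, map_smul]
  module

theorem bracket_baseSymbol_symbol_multiplier_eq_differential {n : ℕ}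
    (f : Cochain K A' A (n + 1)) :
    (ListSymbol.bracket P.bicrossedMul 1 (n + 1) (baseSymbol K A A') (P.symbol f)).multiplier =
      listInl K (evalList (P.differential f)) := by
  have circ_base : listCirc K 1 (baseSymbol K A A').field (evalList f) =
      evalList (-∑ i : Fin (n + 1), (-1 : K) ^ (i : ℕ) • insertAt rfl i f
        (pairing (LinearMap.mul K A') rfl (idCochain K A') (idCochain K A'))) := by
    have sum_insertAt := evalList_sum_insertAt rfl f
      (pairing (LinearMap.mul K A') rfl (idCochain K A') (idCochain K A'))
    simp only [Nat.mul_one] at sum_insertAt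
    rw [map_neg, sum_insertAt, baseSymbol, ← (listMultilinear_evalList f).circHom_apply,
      ← (listMultilinear_evalList f).circHom_apply, map_neg, map_neg]
  rw [bracket_baseSymbol_symbol_multiplier, circ_base, ← map_add, ← map_smul, ← map_sub]
  congr 2
  simp only [differential, pow_succ, mul_neg, mul_one, neg_smul, Finset.sum_neg_distrib]
  module

theorem symbol_eq_of_bracket_baseSymbol_mem {m : ℕ} {p q : ListSymbol A' (A × A')}
    (hp : HasArity (m + 1) p.field) (hq : HasArity (m + 1) q.field)
    (h : p.multiplier = q.multiplier)
    (hDp : (ListSymbol.bracket P.bicrossedMul 1 m (baseSymbol K A A') p).multiplier ∈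
      leftValued K A' A A')
    (hDq : (ListSymbol.bracket P.bicrossedMul 1 m (baseSymbol K A A') q).multiplier ∈
      leftValued K A' A A') : p = q := by
  have bracket_base {p : ListSymbol A' (A × A')} (hp : HasArity (m + 1) p.field) :
      (ListSymbol.bracket P.bicrossedMul 1 m (baseSymbol K A A') p).multiplier =
        listInr K p.field + (listCup P.bicrossedMul m p.multiplier (listIncl K A A') -
          (-1 : K) ^ (1 * m) • (baseSymbol K A A').op P.bicrossedMul 1 p.multiplier) := by
    rw [← listCirc_listIncl m hp, ListSymbol.bracket, op_apply, baseSymbol]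
    module
  have field_sub_mem := sub_mem hDp hDq
  rw [bracket_base hp, bracket_base hq, h, add_sub_add_right_eq_sub, ← map_sub] at field_sub_mem
  exact ListSymbol.ext h (sub_eq_zero.mp (eq_zero_of_listInr_mem_leftValued field_sub_mem))

theorem bracket_baseSymbol_symbol_mem_leftValued {m : ℕ} (f : Cochain K A' A m) :
    (ListSymbol.bracket P.bicrossedMul 1 m (baseSymbol K A A') (P.symbol f)).multiplier ∈
      leftValued K A' A A' := by
  rw [bracket_baseSymbol_symbol_multiplier]
  exact listInl_mem_leftValued _

theorem symbol_bracket {m n N : ℕ} (h : N = m + n) (f : Cochain K A' A m) (g : Cochain K A' A n) :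
    P.symbol (P.bracket h f g) =
      ListSymbol.bracket P.bicrossedMul m n (P.symbol f) (P.symbol g) := by
  subst h
  refine P.symbol_eq_of_bracket_baseSymbol_mem (P.symbol_isHomogeneous _).field_arity
    (bracket_field_arity (P.symbol_isHomogeneous f) (P.symbol_isHomogeneous g))
    (P.bracket_symbol_symbol_multiplier rfl f g).symm
    (P.bracket_baseSymbol_symbol_mem_leftValued _) ?_
  rw [bracket_multiplier_jacobi P.bicrossedMul_assoc baseSymbol_isHomogeneous
    (P.symbol_isHomogeneous f) (P.symbol_isHomogeneous g)]
  exact add_mem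
    (P.bracket_multiplier_mem_leftValued _ _ (P.bracket_baseSymbol_symbol_mem_leftValued f)
      (listInl_mem_leftValued _))
    (Submodule.smul_mem _ _ (P.bracket_multiplier_mem_leftValued _ _ (listInl_mem_leftValued _)
      (P.bracket_baseSymbol_symbol_mem_leftValued g)))

theorem bracket_baseSymbol_bracket_baseSymbol_symbol {m : ℕ} (f : Cochain K A' A m) :
    (ListSymbol.bracket P.bicrossedMul 1 (1 + m) (baseSymbol K A A')
      (ListSymbol.bracket P.bicrossedMul 1 m (baseSymbol K A A') (P.symbol f))).multiplier = 0 :=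
  bracket_bracket_self_multiplier P.bicrossedMul_assoc odd_one baseSymbol_isHomogeneous
    P.op_baseSymbol_multiplier listCirc_baseSymbol_field (P.symbol_isHomogeneous f)

theorem symbol_differential {n : ℕ} (f : Cochain K A' A (n + 1)) :
    P.symbol (P.differential f) =
      ListSymbol.bracket P.bicrossedMul 1 (n + 1) (baseSymbol K A A') (P.symbol f) := by
  have degree : n + 2 = 1 + (n + 1) := Nat.add_comm (n + 1) 1
  refine P.symbol_eq_of_bracket_baseSymbol_mem (P.symbol_isHomogeneous _).field_arity ?_
    (P.bracket_baseSymbol_symbol_multiplier_eq_differential f).symm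
    (P.bracket_baseSymbol_symbol_mem_leftValued _) ?_
  · rw [degree]
    exact bracket_field_arity baseSymbol_isHomogeneous (P.symbol_isHomogeneous f)
  · rw [degree, bracket_baseSymbol_bracket_baseSymbol_symbol]
    exact zero_mem _

end MatchedPair

/-! ### The differential graded Lie algebra -/

namespace MatchedPair

open ListSymbol (bracket_multiplier_skew bracket_multiplier_jacobi)

variable {K A A' : Type*} [Field K] [NonUnitalRing A] [Module K A] [NonUnitalRing A'] [Module K A']

variable (K A A') in
/-- The inclusion of `Hom(⊗^{n+1} A', A)` as the homogeneous elements of degree `n + 1`. -/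
abbrev homogeneous (n : ℕ) : Cochain K A' A (n + 1) →ₗ[K] ControlSpace K A A' :=
  DirectSum.lof K ℕ (fun n => Cochain K A' A (n + 1)) n

theorem homogeneous_apply_self (n : ℕ) (f : Cochain K A' A (n + 1)) :
    homogeneous K A A' n f n = f :=
  DirectSum.lof_apply (M := fun n => Cochain K A' A (n + 1)) K n f

theorem homogeneous_apply_of_ne {n k : ℕ} (h : k ≠ n) (f : Cochain K A' A (n + 1)) :
    homogeneous K A A' n f k = 0 :=
  DirectSum.of_eq_of_ne _ _ _ h

theorem homogeneous_injective (n : ℕ) : Function.Injective (homogeneous K A A' n) :=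
  fun f g h => by rw [← homogeneous_apply_self n f, h, homogeneous_apply_self]

theorem homogeneous_mem (n : ℕ) (f : Cochain K A' A (n + 1)) {i : ℤ} (hi : i = n + 1) :
    homogeneous K A A' n f ∈ controlGrading K A A' i :=
  fun _ hk => homogeneous_apply_of_ne (by omega) f

theorem exists_homogeneous_of_mem {n : ℕ} {x : ControlSpace K A A'}
    (hx : x ∈ controlGrading K A A' (n + 1)) :
    ∃ f : Cochain K A' A (n + 1), x = homogeneous K A A' n f := by
  refine ⟨x n, DFinsupp.ext fun k => ?_⟩
  obtain rfl | hk := eq_or_ne k n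
  · exact (homogeneous_apply_self k (x k)).symm
  · exact (hx k (by omega)).trans (homogeneous_apply_of_ne hk _).symm

theorem eq_zero_or_homogeneous_of_mem {i : ℤ} {x : ControlSpace K A A'}
    (hx : x ∈ controlGrading K A A' i) :
    x = 0 ∨ ∃ (n : ℕ) (f : Cochain K A' A (n + 1)), i = ((n + 1 : ℕ) : ℤ) ∧
      x = homogeneous K A A' n f := by
  by_cases hi : 1 ≤ i
  · obtain ⟨n, rfl⟩ : ∃ n : ℕ, i = n + 1 := ⟨(i - 1).toNat, by omega⟩
    exact Or.inr ⟨n, (exists_homogeneous_of_mem hx).imp fun f hf => ⟨rfl, hf⟩⟩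
  · exact Or.inl (DFinsupp.ext fun k => hx k (by omega))

theorem ofLinearMap_injective :
    Function.Injective (ofLinearMap : (A' →ₗ[K] A) → ControlSpace K A A') :=
  (homogeneous_injective 0).comp (MultilinearMap.ofSubsingleton K A' A (0 : Fin 1)).injective

theorem ofLinearMap_mem (B : A' →ₗ[K] A) : ofLinearMap B ∈ controlGrading K A A' 1 :=
  homogeneous_mem 0 _ (by simp)

theorem exists_ofLinearMap_of_mem {x : ControlSpace K A A'} (hx : x ∈ controlGrading K A A' 1) :
    ∃ B : A' →ₗ[K] A, ofLinearMap B = x := by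
  obtain ⟨f, rfl⟩ := exists_homogeneous_of_mem (n := 0) hx
  refine ⟨(MultilinearMap.ofSubsingleton K A' A (0 : Fin 1)).symm f, ?_⟩
  rw [ofLinearMap, Equiv.apply_symm_apply]

theorem isInternal_controlGrading : DirectSum.IsInternal (controlGrading K A A') := by
  classical
  let toComponent (n : ℕ) : Cochain K A' A (n + 1) →ₗ[K] controlGrading K A A' (n + 1) :=
    (homogeneous K A A' n).codRestrict _ fun f => homogeneous_mem n f rfl
  let decompose : ControlSpace K A A' →ₗ[K] DirectSum ℤ fun i => controlGrading K A A' i :=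
    DirectSum.toModule K ℕ _ fun n =>
      DirectSum.lof K ℤ (fun i => controlGrading K A A' i) (n + 1) ∘ₗ toComponent n
  have decompose_homogeneous (n : ℕ) (f : Cochain K A' A (n + 1)) :
      decompose (homogeneous K A A' n f) = DirectSum.lof K ℤ _ (n + 1) (toComponent n f) :=
    DirectSum.toModule_lof (M := fun n => Cochain K A' A (n + 1)) K n f
  let decomposition := DirectSum.Decomposition.ofLinearMap (controlGrading K A A') decompose
    (DirectSum.linearMap_ext K fun n => LinearMap.ext fun f =>
      (congrArg (DirectSum.coeLinearMap _) (decompose_homogeneous n f)).trans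
        (DirectSum.coeLinearMap_lof (controlGrading K A A') _ (toComponent n f)))
    (DirectSum.linearMap_ext K fun i => LinearMap.ext fun ⟨x, hx⟩ => by
      simp only [LinearMap.comp_apply, DirectSum.coeLinearMap_lof, LinearMap.id_apply]
      obtain rfl | ⟨n, f, rfl, rfl⟩ := eq_zero_or_homogeneous_of_mem hx
      · exact (map_zero _).trans (map_zero _).symm
      · exact decompose_homogeneous n f)
  exact DirectSum.Decomposition.isInternal _

variable (K A A') in
/-- The elements of the control space as functions on lists with values in `A ⋈ A'`, the multipliers
of their symbols. -/
def controlMultiplier : ControlSpace K A A' →ₗ[K] (List A' → A × A') :=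
  listInl K ∘ₗ LinearMap.pi fun l => LinearMap.proj l ∘ₗ evalList ∘ₗ
    DirectSum.component K ℕ (fun n => Cochain K A' A (n + 1)) (l.length - 1)

theorem controlMultiplier_apply (x : ControlSpace K A A') {n : ℕ} {l : List A'}
    (hl : l.length = n + 1) : controlMultiplier K A A' x l = (evalList (x n) l, 0) := by
  obtain rfl : n = l.length - 1 := by omega
  rfl

theorem controlMultiplier_injective : Function.Injective (controlMultiplier K A A') := by
  intro x y h
  refine DFinsupp.ext fun n => MultilinearMap.ext fun u => ?_
  have eval_eq := congrFun h (List.ofFn u)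
  rw [controlMultiplier_apply x (n := n) (by simp),
    controlMultiplier_apply y (n := n) (by simp), evalList_ofFn,
    evalList_ofFn] at eval_eq
  exact congrArg Prod.fst eval_eq

variable (P : MatchedPair K A A')

theorem controlMultiplier_homogeneous (n : ℕ) (f : Cochain K A' A (n + 1)) :
    controlMultiplier K A A' (homogeneous K A A' n f) = (P.symbol f).multiplier := by
  ext1 l
  change (evalList (homogeneous K A A' n f (l.length - 1)) l, (0 : A')) = (evalList f l, 0)
  obtain rfl | h := eq_or_ne n (l.length - 1)
  · rw [homogeneous_apply_self]
  · rw [homogeneous_apply_of_ne h.symm, hasArity_evalList f l (by omega), map_zero, Pi.zero_apply]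

variable [IsScalarTower K A A] [SMulCommClass K A A]

theorem controlBracket_homogeneous (p q : ℕ) (f : Cochain K A' A (p + 1))
    (g : Cochain K A' A (q + 1)) :
    P.controlBracket (homogeneous K A A' p f) (homogeneous K A A' q g) =
      homogeneous K A A' (p + q + 1) (P.bracket (by omega) f g) := by
  simp only [controlBracket, homogeneous, DirectSum.toModule_lof, LinearMap.flip_apply,
    LinearMap.compr₂_apply]
  rfl

variable [IsScalarTower K A' A'] [SMulCommClass K A' A']

omit [IsScalarTower K A A] [SMulCommClass K A A] in
theorem controlDifferential_homogeneous (n : ℕ) (f : Cochain K A' A (n + 1)) :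
    P.controlDifferential (homogeneous K A A' n f) =
      homogeneous K A A' (n + 1) (P.differential f) := by
  simp only [controlDifferential, homogeneous, DirectSum.toModule_lof]
  rfl

theorem controlBracket_skew {p q : ℕ} (f : Cochain K A' A (p + 1)) (g : Cochain K A' A (q + 1)) :
    P.controlBracket (homogeneous K A A' p f) (homogeneous K A A' q g) =
      -((-1 : K) ^ ((p + 1) * (q + 1)) •
        P.controlBracket (homogeneous K A A' q g) (homogeneous K A A' p f)) := by
  apply controlMultiplier_injective
  simp only [controlBracket_homogeneous, map_neg, map_smul, P.controlMultiplier_homogeneous,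
    symbol_bracket]
  exact bracket_multiplier_skew _ _ _ _ _

theorem controlBracket_jacobi {p q r : ℕ} (f : Cochain K A' A (p + 1))
    (g : Cochain K A' A (q + 1)) (h : Cochain K A' A (r + 1)) :
    P.controlBracket (homogeneous K A A' p f)
        (P.controlBracket (homogeneous K A A' q g) (homogeneous K A A' r h)) =
      P.controlBracket (P.controlBracket (homogeneous K A A' p f) (homogeneous K A A' q g))
          (homogeneous K A A' r h) +
        (-1 : K) ^ ((p + 1) * (q + 1)) • P.controlBracket (homogeneous K A A' q g)
          (P.controlBracket (homogeneous K A A' p f) (homogeneous K A A' r h)) := by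
  apply controlMultiplier_injective
  simp only [controlBracket_homogeneous, map_add, map_smul, P.controlMultiplier_homogeneous,
    symbol_bracket, show ∀ a b : ℕ, a + b + 1 + 1 = (a + 1) + (b + 1) by intros; omega]
  exact bracket_multiplier_jacobi P.bicrossedMul_assoc (P.symbol_isHomogeneous f)
    (P.symbol_isHomogeneous g) (P.symbol_isHomogeneous h)

theorem controlDifferential_controlDifferential (x : ControlSpace K A A') :
    P.controlDifferential (P.controlDifferential x) = 0 := by
  induction x using DirectSum.induction_on with
  | zero => simp
  | of n f =>
    change P.controlDifferential (P.controlDifferential (homogeneous K A A' n f)) = 0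
    apply controlMultiplier_injective
    simp only [controlDifferential_homogeneous, P.controlMultiplier_homogeneous,
      symbol_differential, map_zero, Nat.add_comm (n + 1) 1]
    exact P.bracket_baseSymbol_bracket_baseSymbol_symbol f
  | add x y hx hy => simp [hx, hy]

theorem controlDifferential_controlBracket {p q : ℕ} (f : Cochain K A' A (p + 1))
    (g : Cochain K A' A (q + 1)) :
    P.controlDifferential
        (P.controlBracket (homogeneous K A A' p f) (homogeneous K A A' q g)) =
      P.controlBracket (P.controlDifferential (homogeneous K A A' p f))
          (homogeneous K A A' q g) +
        (-1 : K) ^ (p + 1) • P.controlBracket (homogeneous K A A' p f)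
          (P.controlDifferential (homogeneous K A A' q g)) := by
  apply controlMultiplier_injective
  simp only [controlBracket_homogeneous, controlDifferential_homogeneous, map_add, map_smul,
    P.controlMultiplier_homogeneous, symbol_bracket, symbol_differential,
    show p + q + 1 + 1 = (p + 1) + (q + 1) by omega]
  have jacobi := bracket_multiplier_jacobi P.bicrossedMul_assoc baseSymbol_isHomogeneous
    (P.symbol_isHomogeneous f) (P.symbol_isHomogeneous g)
  simpa only [Nat.one_mul, Nat.add_comm 1] using jacobi

theorem isDGLieAlgebra_control :
    IsDGLieAlgebra (controlGrading K A A') P.controlBracket P.controlDifferential where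
  isInternal := isInternal_controlGrading
  bracket_mem i j x y hx hy := by
    obtain rfl | ⟨p, f, rfl, rfl⟩ := eq_zero_or_homogeneous_of_mem hx
    · simp
    obtain rfl | ⟨q, g, rfl, rfl⟩ := eq_zero_or_homogeneous_of_mem hy
    · simp
    rw [controlBracket_homogeneous]
    exact homogeneous_mem _ _ (by push_cast; ring)
  skew i j x y hx hy := by
    obtain rfl | ⟨p, f, rfl, rfl⟩ := eq_zero_or_homogeneous_of_mem hx
    · simp
    obtain rfl | ⟨q, g, rfl, rfl⟩ := eq_zero_or_homogeneous_of_mem hy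
    · simp
    rw [← Nat.cast_mul, zpow_natCast]
    exact P.controlBracket_skew f g
  jacobi i j k x y z hx hy hz := by
    obtain rfl | ⟨p, f, rfl, rfl⟩ := eq_zero_or_homogeneous_of_mem hx
    · simp
    obtain rfl | ⟨q, g, rfl, rfl⟩ := eq_zero_or_homogeneous_of_mem hy
    · simp
    obtain rfl | ⟨r, h, rfl, rfl⟩ := eq_zero_or_homogeneous_of_mem hz
    · simp
    rw [← Nat.cast_mul, zpow_natCast]
    exact P.controlBracket_jacobi f g h
  d_mem i x hx := by
    obtain rfl | ⟨p, f, rfl, rfl⟩ := eq_zero_or_homogeneous_of_mem hx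
    · simp
    rw [controlDifferential_homogeneous]
    exact homogeneous_mem _ _ (by push_cast; ring)
  d_d := P.controlDifferential_controlDifferential
  leibniz i j x y hx hy := by
    obtain rfl | ⟨p, f, rfl, rfl⟩ := eq_zero_or_homogeneous_of_mem hx
    · simp
    obtain rfl | ⟨q, g, rfl, rfl⟩ := eq_zero_or_homogeneous_of_mem hy
    · simp
    rw [zpow_natCast]
    exact P.controlDifferential_controlBracket f g

/-! ### Maurer–Cartan elements -/

/-- A linear map `A' → A`, as an element of `Hom(⊗¹ A', A)`. -/
abbrev linearCochain (B : A' →ₗ[K] A) : Cochain K A' A 1 :=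
  MultilinearMap.ofSubsingleton K A' A (0 : Fin 1) B

omit [IsScalarTower K A A] [SMulCommClass K A A] in
theorem differential_linearCochain_apply (B : A' →ₗ[K] A) (u : Fin 2 → A') :
    P.differential (linearCochain B) u =
      P.ξ (u 1) (B (u 0)) + P.η (u 0) (B (u 1)) - B (u 0 * u 1) := by
  simp [differential, pairing, insertAt, insertArgs, idCochain, sub_eq_add_neg]

omit [IsScalarTower K A' A'] [SMulCommClass K A' A'] in
theorem bracket_linearCochain_self_apply (B : A' →ₗ[K] A) (u : Fin 2 → A') :
    P.bracket rfl (linearCochain B) (linearCochain B) u =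
      (2 : K) • (B (u 0) * B (u 1) - B (P.ρ (B (u 0)) (u 1)) - B (P.μ (B (u 1)) (u 0))) := by
  have expand : P.bracket rfl (linearCochain B) (linearCochain B) u =
      B (u 0) * B (u 1) + B (u 0) * B (u 1) - B (P.μ (B (u 1)) (u 0)) -
        B (P.ρ (B (u 0)) (u 1)) - B (P.ρ (B (u 0)) (u 1)) - B (P.μ (B (u 1)) (u 0)) := by
    simp [bracket, pairing, insertAt, insertArgs, rhoCochain, muCochain, idCochain,
      sub_eq_add_neg]
  rw [expand]
  module

theorem differential_add_bracket_linearCochain_apply (h2 : (2 : K) ≠ 0) (B : A' →ₗ[K] A)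
    (u : Fin 2 → A') :
    (P.differential (linearCochain B) +
      (2⁻¹ : K) • P.bracket rfl (linearCochain B) (linearCochain B)) u =
      B (u 0) * B (u 1) + P.ξ (u 1) (B (u 0)) + P.η (u 0) (B (u 1)) -
        B (u 0 * u 1 + P.ρ (B (u 0)) (u 1) + P.μ (B (u 1)) (u 0)) := by
  rw [add_apply, smul_apply, differential_linearCochain_apply,
    bracket_linearCochain_self_apply, inv_smul_smul₀ h2]
  simp only [map_add]
  abel

theorem controlDifferential_add_controlBracket_ofLinearMap (B : A' →ₗ[K] A) :
    P.controlDifferential (ofLinearMap B) +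
        (2⁻¹ : K) • P.controlBracket (ofLinearMap B) (ofLinearMap B) =
      homogeneous K A A' 1 (P.differential (linearCochain B) +
        (2⁻¹ : K) • P.bracket rfl (linearCochain B) (linearCochain B)) := by
  rw [map_add, map_smul]
  exact congrArg₂ (fun x y => x + (2⁻¹ : K) • y)
    (P.controlDifferential_homogeneous 0 (linearCochain B))
    (P.controlBracket_homogeneous 0 0 (linearCochain B) (linearCochain B))

theorem maurerCartan_ofLinearMap_iff (h2 : (2 : K) ≠ 0) (B : A' →ₗ[K] A) :
    P.controlDifferential (ofLinearMap B) +
        (2⁻¹ : K) • P.controlBracket (ofLinearMap B) (ofLinearMap B) = 0 ↔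
      P.IsDeformationMap B := by
  rw [controlDifferential_add_controlBracket_ofLinearMap,
    map_eq_zero_iff _ (homogeneous_injective 1), MultilinearMap.ext_iff]
  simp only [P.differential_add_bracket_linearCochain_apply h2, zero_apply,
    sub_eq_zero]
  exact ⟨fun h u v => h ![u, v], fun h u => h (u 0) (u 1)⟩

end MatchedPair

theorem mainTheorem4 {K A A' : Type*} [Field K] (h2 : (2 : K) ≠ 0)
    [NonUnitalRing A] [Module K A] [IsScalarTower K A A] [SMulCommClass K A A]
    [NonUnitalRing A'] [Module K A'] [IsScalarTower K A' A'] [SMulCommClass K A' A']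
    (P : MatchedPair K A A') :
    IsDGLieAlgebra (MatchedPair.controlGrading K A A') P.controlBracket P.controlDifferential ∧
    Set.BijOn (fun B : A' →ₗ[K] A => MatchedPair.ofLinearMap B)
      {B | P.IsDeformationMap B}
      {x | IsMaurerCartan (MatchedPair.controlGrading K A A')
        P.controlBracket P.controlDifferential x} := by
  refine ⟨P.isDGLieAlgebra_control, fun B hB => ?_, MatchedPair.ofLinearMap_injective.injOn, ?_⟩
  · exact ⟨MatchedPair.ofLinearMap_mem B, (P.maurerCartan_ofLinearMap_iff h2 B).mpr hB⟩
  · rintro x ⟨hx, hmc⟩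
    obtain ⟨B, rfl⟩ := MatchedPair.exists_ofLinearMap_of_mem hx
    exact ⟨B, (P.maurerCartan_ofLinearMap_iff h2 B).mp hmc, rfl⟩
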